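/- Let $\mathcal N$ be a finite irreducible abelian network that halts on all inputs. The terms mean the following. **Network.** Let $G=(V,E)$ be a finite directed graph (loops allowed), with a finite alphabet $A_v$ and a finite state space $Q_v$ at each vertex; put $A=\bigsqcup_v A_v$ and $Q=\prod_v Q_v$. At each $v$ there is an abelian processor: commuting maps $t_a:Q_v\to Q_v$ $(a\in A_v)$ and message functions $o_a^u:Q_v\to A_u^*$ for $a\in A_v$, $(v,u)\in E$, such that two input words that are equal up to permutation, read from the same state, produce on each edge output words that are equal up to permutation. $\mathcal N$ is *irreducible* if for each $v$ the set $Q_v$ is nonempty and for all $p,p'\in Q_v$ there are $m,m'$ in the local monoid $M_v=\langle t_a\rangle_{a\in A_v}\subset \mathrm{End}(Q_v)$ with $mp=m'p'$. **Executions.** For $\mathbf x\in\mathbb Z^A$ and $\mathbf q\in Q$, processing a letter $a\in A_v$ from $\mathbf x.\mathbf q$ lowers $\mathbf x_a$ by one, replaces $\mathbf q_v$ by $t_a(\mathbf q_v)$, and adds to $\mathbf x$ the letters of the messages $o_a^u(\mathbf q_v)$ over all edges $(v,u)$. A word is *legal* for $\mathbf x.\mathbf q$ if each of its letters $a$ is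 processed when the current $a$-coordinate is at least $1$, and *complete* if the final vector is $\le\mathbf 0$. $\mathcal N$ *halts on all inputs* if every $\mathbf x.\mathbf q$ with $\mathbf x\in\mathbb N^A$, $\mathbf q\in Q$ has a complete legal execution. The final state, which does not depend on that execution, is written $\mathbf x\triangleright\!\triangleright\mathbf q$. **Critical group.** The *minimal idempotent* of a finite commutative monoid is the product of all its idempotents. Let $\tau_a(\mathbf q)=1_a\triangleright\!\triangleright\mathbf q$, let $M=\langle\tau_a\rangle_{a\in A}\subset\mathrm{End}(Q)$, a finite commutative monoid, and let $e$ be its minimal idempotent. The *critical group* is the abelian group $\mathrm{Crit}\,\mathcal N=eM$ with identity $e$. The *natural map* $\mathbb Z^A\to\mathrm{Crit}\,\mathcal N$ is the group homomorphism with $1_a\mapsto e\tau_a$. **Laplacian.** Let $e_v$ be the minimal idempotent of $M_v$. The maps $t_a$ $(a\in A_v)$ permute $e_vQ_v$, so $\mathbb Z^{A_v}$ acts on $e_vQ_v$; let $K_v$ be the kernel of this action and $K=\prod_vK_v\subset\mathbb Z^A$, a subgroup of finite index. A state $\mathbf q$ is *locally recurrent* if $\mathbf q_v\in e_vQ_v$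 for all $v$. For such $\mathbf q$ the *production map* $P:K\to\mathbb Z^A$ is the group homomorphism such that for $\mathbf k\in K\cap\mathbb N^A$, processing exactly the letters $\mathbf k$ from $\mathbf k.\mathbf q$ results in $P(\mathbf k).\mathbf q$; it does not depend on the choice of $\mathbf q$. Write $P$ also for the $A\times A$ rational matrix of its $\mathbb Q$-linear extension. Let $r_a=\min\{m\ge1: m1_a\in K\}$, let $D$ be the diagonal matrix with entries $r_a$, and let $L=(I-P)D$, which maps $\mathbb Z^A$ into $\mathbb Z^A$. $\mathcal N$ is *rectangular* if $K=\prod_{a\in A}r_a\mathbb Z$. **Statement.** The natural map $\mathbb Z^A\to\mathrm{Crit}\,\mathcal N$ induces a surjective group homomorphism $$\phi:\mathbb Z^A/L\mathbb Z^A\twoheadrightarrow\mathrm{Crit}\,\mathcal N .$$ If $\mathcal N$ is rectangular, then $\phi$ is an isomorphism. -/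

import Mathlib

namespace AbelianNet

/-! ### Finite commutative monoids and their actions -/

section Monoids

/-- The minimal idempotent of a finite commutative monoid: the product of all its idempotents. -/
noncomputable def minIdempotent (M : Type*) [CommMonoid M] [Finite M] : M :=
  ∏ f ∈ (Set.toFinite {f : M | f * f = f}).toFinset, f

theorem minIdempotent_mul_self (M : Type*) [CommMonoid M] [Finite M] :
    minIdempotent M * minIdempotent M = minIdempotent M := by
  unfold minIdempotent
  rw [← Finset.prod_mul_distrib]
  refine Finset.prod_congr rfl fun f hf => ?_
  simpa using hf

theorem exists_idempotent_pow {M : Type*} [CommMonoid M] [Finite M] (m : M) :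
    ∃ j : ℕ, 1 ≤ j ∧ m ^ j * m ^ j = m ^ j := by
  obtain ⟨a, b, hab, h⟩ : ∃ a b : ℕ, a < b ∧ m ^ a = m ^ b := by
    obtain ⟨a, b, hne, h⟩ := Finite.exists_ne_map_eq_of_infinite (fun n : ℕ => m ^ n)
    rcases lt_or_gt_of_ne hne with hlt | hlt
    · exact ⟨a, b, hlt, h⟩
    · exact ⟨b, a, hlt, h.symm⟩
  obtain ⟨d, rfl⟩ := Nat.exists_eq_add_of_lt hab
  have hper : ∀ k n : ℕ, a ≤ n → m ^ (n + k * (d + 1)) = m ^ n := by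
    intro k
    induction k with
    | zero => intro n _; simp
    | succ k ih =>
      intro n hn
      have h1 : n + (k + 1) * (d + 1) = (n + (d + 1)) + k * (d + 1) := by ring
      rw [h1, ih (n + (d + 1)) (by omega)]
      obtain ⟨c, rfl⟩ := Nat.exists_eq_add_of_le hn
      have h2 : a + c + (d + 1) = (a + d + 1) + c := by ring
      rw [h2, pow_add, ← h, ← pow_add]
  refine ⟨(a + 1) * (d + 1), ?_, ?_⟩
  · exact Nat.succ_le_of_lt (Nat.mul_pos (Nat.succ_pos _) (Nat.succ_pos _))
  · rw [← pow_add]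
    exact hper (a + 1) ((a + 1) * (d + 1)) (by nlinarith)

/-- The minimal idempotent is accessible from every element. -/
theorem exists_mul_eq_minIdempotent {M : Type*} [CommMonoid M] [Finite M] (m : M) :
    ∃ m' : M, m * m' = minIdempotent M := by
  obtain ⟨j, hj, h⟩ := exists_idempotent_pow m
  have hd : m ^ j ∣ minIdempotent M :=
    Finset.dvd_prod_of_mem (fun f : M => f) (by simpa using h)
  have hm : m ∣ m ^ j := dvd_pow_self m (by omega)
  obtain ⟨c, hc⟩ := hm.trans hd
  exact ⟨c, hc.symm⟩

/-- The subset `eM` of a finite commutative monoid `M` with minimal idempotent `e`. -/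
def MinGroup (M : Type*) [CommMonoid M] [Finite M] : Type _ :=
  {x : M // ∃ m : M, x = minIdempotent M * m}

theorem MinGroup.minIdempotent_mul {M : Type*} [CommMonoid M] [Finite M] (g : MinGroup M) :
    minIdempotent M * g.1 = g.1 := by
  obtain ⟨x, m, rfl⟩ := g
  simp only
  rw [← mul_assoc, minIdempotent_mul_self]

theorem MinGroup.exists_inv {M : Type*} [CommMonoid M] [Finite M] (g : MinGroup M) :
    ∃ h : MinGroup M, h.1 * g.1 = minIdempotent M := by
  obtain ⟨c, hc⟩ := exists_mul_eq_minIdempotent g.1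
  refine ⟨⟨minIdempotent M * c, c, rfl⟩, ?_⟩
  simp only
  rw [mul_assoc, mul_comm c, hc, minIdempotent_mul_self]

/-- `eM` is an abelian group under the multiplication of `M`, with identity element `e`. -/
noncomputable instance (M : Type*) [CommMonoid M] [Finite M] : CommGroup (MinGroup M) where
  mul g h := ⟨g.1 * h.1, g.1 * h.1, by
    rw [← mul_assoc, MinGroup.minIdempotent_mul]⟩
  one := ⟨minIdempotent M, 1, by rw [mul_one]⟩
  inv g := Classical.choose g.exists_inv
  mul_assoc g h k := Subtype.ext (mul_assoc g.1 h.1 k.1)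
  one_mul g := Subtype.ext g.minIdempotent_mul
  mul_one g := Subtype.ext ((mul_comm _ _).trans g.minIdempotent_mul)
  mul_comm g h := Subtype.ext (mul_comm g.1 h.1)
  inv_mul_cancel g := Subtype.ext (Classical.choose_spec g.exists_inv)

instance (M : Type*) [CommMonoid M] [Finite M] : Finite (MinGroup M) :=
  inferInstanceAs (Finite {x : M // ∃ m : M, x = minIdempotent M * m})

/-- The map `M → eM`, `m ↦ e m`. -/
noncomputable def toMinGroup {M : Type*} [CommMonoid M] [Finite M] (m : M) : MinGroup M :=
  ⟨minIdempotent M * m, m, rfl⟩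

/-- Given a family `(g a)` in `M`, the group homomorphism `ℤ^I → eM` with `1_a ↦ e (g a)`. -/
noncomputable def naturalMap {M : Type*} [CommMonoid M] [Finite M] {I : Type*} [Fintype I]
    (g : I → M) : (I → ℤ) →+ Additive (MinGroup M) where
  toFun x := ∑ a, x a • Additive.ofMul (toMinGroup (g a))
  map_zero' := by simp
  map_add' x y := by simp [add_smul, Finset.sum_add_distrib]

theorem naturalMap_single {M : Type*} [CommMonoid M] [Finite M] {I : Type*} [Fintype I]
    [DecidableEq I] (g : I → M) (a : I) :
    naturalMap g (Pi.single a 1) = Additive.ofMul (toMinGroup (g a)) := by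
  change ∑ b, (Pi.single a 1 : I → ℤ) b • Additive.ofMul (toMinGroup (g b)) = _
  rw [Finset.sum_eq_single a]
  · simp
  · intro b _ hb
    simp [hb]
  · simp

/-- An action is irreducible if the relation `x ∼ x'` given by `m x = m' x'` for some `m, m'`
has exactly one class. -/
def IsIrreducibleAction (M X : Type*) [Monoid M] [MulAction M X] : Prop :=
  Nonempty X ∧ ∀ x x' : X, ∃ m m' : M, m • x = m' • x'

/-- The set `eX` of recurrent elements. -/
def recurrentSet (M X : Type*) [CommMonoid M] [Finite M] [MulAction M X] : Set X :=
  Set.range fun x : X => minIdempotent M • x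

theorem minIdempotent_smul {M X : Type*} [CommMonoid M] [Finite M] [MulAction M X] {x : X}
    (hx : x ∈ recurrentSet M X) : minIdempotent M • x = x := by
  obtain ⟨y, rfl⟩ := hx
  simp only
  rw [← mul_smul, minIdempotent_mul_self]

/-- The restriction of an action `M × X → X` to a group action `eM × eX → eX`. -/
noncomputable instance (M X : Type*) [CommMonoid M] [Finite M] [MulAction M X] :
    MulAction (MinGroup M) (recurrentSet M X) where
  smul g x := ⟨g.1 • x.1, g.1 • x.1, by
    change minIdempotent M • (g.1 • x.1) = g.1 • x.1
    rw [← mul_smul, g.minIdempotent_mul]⟩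
  one_smul x := Subtype.ext (minIdempotent_smul x.2)
  mul_smul g h x := Subtype.ext (mul_smul g.1 h.1 x.1)

theorem toMinGroup_smul {M X : Type*} [CommMonoid M] [Finite M] [MulAction M X] (m : M)
    (x : recurrentSet M X) : (toMinGroup m • x).1 = m • x.1 := by
  change (minIdempotent M * m) • x.1 = _
  rw [mul_comm, mul_smul, minIdempotent_smul x.2]

end Monoids

/-! ### Abelian processors -/

section Processors

/-- The word output on feed `u` when the input word is read starting from state `q`. -/
def outputWord {I Q U : Type*} {B : U → Type*} (t : I → Function.End Q)
    (o : I → (u : U) → Q → List (B u)) (u : U) : List I → Q → List (B u)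
  | [], _ => []
  | a :: w, q => o a u q ++ outputWord t o u w (t a q)

/-- An abelian processor with input alphabet `I`, state space `Q` and output alphabets
`(B u)`, `u : U`. -/
structure Processor (I Q : Type*) {U : Type*} (B : U → Type*) where
  /-- state transitions -/
  t : I → Function.End Q
  /-- message passing -/
  o : I → (u : U) → Q → List (B u)
  t_comm : ∀ a b : I, t a * t b = t b * t a
  out_perm : ∀ w w' : List I, w.Perm w' → ∀ (q : Q) (u : U),
    (outputWord t o u w q).Perm (outputWord t o u w' q)

variable {I Q U : Type*} {B : U → Type*}

/-- The transition monoid, generated by the transition maps inside `End Q`. -/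
def Processor.monoid (p : Processor I Q B) : Submonoid (Function.End Q) :=
  Submonoid.closure (Set.range p.t)

theorem mul_comm_of_closure {N : Type*} [Monoid N] {s : Set N}
    (h : ∀ a ∈ s, ∀ b ∈ s, a * b = b * a) (x y : Submonoid.closure s) : x * y = y * x :=
  (Submonoid.isMulCommutative_closure N h).is_comm.comm x y

instance (p : Processor I Q B) : CommMonoid p.monoid :=
  { (inferInstance : Monoid p.monoid) with
    mul_comm := mul_comm_of_closure (by
      rintro _ ⟨a, rfl⟩ _ ⟨b, rfl⟩
      exact p.t_comm a b) }

instance [Finite Q] : Finite (Function.End Q) := inferInstanceAs (Finite (Q → Q))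

/-- The transition maps as elements of the transition monoid. -/
def Processor.gen (p : Processor I Q B) (a : I) : p.monoid :=
  ⟨p.t a, Submonoid.subset_closure ⟨a, rfl⟩⟩

/-- A processor is irreducible if its transition monoid acts irreducibly on its states. -/
def Processor.IsIrreducible (p : Processor I Q B) : Prop :=
  IsIrreducibleAction p.monoid Q

/-- The set `e Q` of recurrent states of a processor. -/
def Processor.recurrent [Finite Q] (p : Processor I Q B) : Set Q :=
  recurrentSet p.monoid Q

/-- The action of `ℤ^I` on `e Q`, in which `1_a` acts by `t_a`. -/
noncomputable def Processor.intAction [Fintype I] [Finite Q] (p : Processor I Q B) :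
    (I → ℤ) →+ Additive (Equiv.Perm (recurrentSet p.monoid Q)) :=
  (MonoidHom.toAdditive (MulAction.toPermHom (MinGroup p.monoid) (recurrentSet p.monoid Q))).comp
    (naturalMap p.gen)

/-- The kernel of the action of `ℤ^I` on `e Q`. -/
noncomputable def Processor.kernel [Fintype I] [Finite Q] (p : Processor I Q B) :
    AddSubgroup (I → ℤ) :=
  p.intAction.ker

theorem Processor.intAction_single [Fintype I] [DecidableEq I] [Finite Q] (p : Processor I Q B)
    (a : I) (q : recurrentSet p.monoid Q) :
    ((p.intAction (Pi.single a 1)).toMul q).1 = p.t a q.1 := by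
  unfold Processor.intAction
  rw [AddMonoidHom.comp_apply, naturalMap_single]
  exact toMinGroup_smul (p.gen a) q

theorem Processor.exists_smul_mem_kernel [Fintype I] [Finite Q] (p : Processor I Q B) :
    ∃ n : ℕ, 0 < n ∧ ∀ x : I → ℤ, n • x ∈ p.kernel := by
  refine ⟨Nat.card (MinGroup p.monoid), Nat.card_pos, fun x => ?_⟩
  have h : Nat.card (MinGroup p.monoid) • naturalMap p.gen x = 0 :=
    pow_card_eq_one' (G := MinGroup p.monoid) (x := (naturalMap p.gen x).toMul)
  unfold Processor.kernel Processor.intAction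
  rw [AddMonoidHom.mem_ker, AddMonoidHom.comp_apply, map_nsmul, h, map_zero]

end Processors
/-! ### Abelian networks -/

/-- An abelian network on the directed graph `G` with alphabets `A v` and state spaces `Q v`:
an abelian processor at each vertex, with one output feed for each outgoing edge. -/
structure Network {V : Type*} (G : Digraph V) (A Q : V → Type*) where
  proc : (v : V) → Processor (A v) (Q v) (fun u : {u : V // G.Adj v u} => A u.1)

namespace Network

section Executions

variable {V : Type*} [DecidableEq V] {G : Digraph V} {A Q : V → Type*} [∀ v, DecidableEq (A v)]

/-- The letters passed when letter `a` is processed at `v` in state `q`, counted by type. -/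
noncomputable def message (N : Network G A Q) (v : V) (a : A v) (q : Q v) : (Σ v, A v) → ℕ :=
  open Classical in fun b =>
    if h : G.Adj v b.1 then ((N.proc v).o a ⟨b.1, h⟩ q).count b.2 else 0

/-- Process one letter `a`: remove it from the vector of waiting letters (possibly incurring a
debt), add the letters that are passed, and change the state of the processor reading it. -/
noncomputable def step (N : Network G A Q) (a : Σ v, A v)
    (s : ((Σ v, A v) → ℤ) × ((v : V) → Q v)) : ((Σ v, A v) → ℤ) × ((v : V) → Q v) :=
  (fun b => s.1 b - (Pi.single a 1 : (Σ v, A v) → ℤ) b + (N.message a.1 a.2 (s.2 a.1) b : ℤ),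
    Function.update s.2 a.1 ((N.proc a.1).t a.2 (s.2 a.1)))

/-- The result `π_w(x.q)` of executing the word `w` from `x.q`. -/
noncomputable def exec (N : Network G A Q) (w : List (Σ v, A v))
    (s : ((Σ v, A v) → ℤ) × ((v : V) → Q v)) : ((Σ v, A v) → ℤ) × ((v : V) → Q v) :=
  w.foldl (fun s a => N.step a s) s

/-- `w` is legal for `s` if each letter is present when it is processed. -/
def Legal (N : Network G A Q) :
    List (Σ v, A v) → ((Σ v, A v) → ℤ) × ((v : V) → Q v) → Prop
  | [], _ => True
  | a :: w, s => 1 ≤ s.1 a ∧ N.Legal w (N.step a s)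

/-- `w` is complete for `s` if it leaves no letters. -/
def Complete (N : Network G A Q) (w : List (Σ v, A v))
    (s : ((Σ v, A v) → ℤ) × ((v : V) → Q v)) : Prop :=
  ∀ a, (N.exec w s).1 a ≤ 0

/-- `N` halts on all inputs: every `x.q` with `x ∈ ℕ^A` has a complete legal execution. -/
def HaltsOnAllInputs (N : Network G A Q) : Prop :=
  ∀ (x : (Σ v, A v) → ℕ) (q : (v : V) → Q v), ∃ w : List (Σ v, A v),
    N.Legal w (fun a => (x a : ℤ), q) ∧ N.Complete w (fun a => (x a : ℤ), q)

variable (N : Network G A Q)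

theorem message_comm (v : V) (a b : A v) (q : Q v) (c : Σ v, A v) :
    N.message v a q c + N.message v b ((N.proc v).t a q) c =
      N.message v b q c + N.message v a ((N.proc v).t b q) c := by
  unfold message
  split_ifs with h
  · have := ((N.proc v).out_perm [a, b] [b, a] (List.Perm.swap b a []) q ⟨c.1, h⟩).count_eq c.2
    simpa [outputWord, List.count_append] using this
  · rfl

theorem step_comm (a b : Σ v, A v) (s : ((Σ v, A v) → ℤ) × ((v : V) → Q v)) :
    N.step a (N.step b s) = N.step b (N.step a s) := by
  obtain ⟨v, a⟩ := a
  obtain ⟨u, b⟩ := b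
  obtain ⟨x, q⟩ := s
  by_cases huv : u = v
  · subst huv
    refine Prod.ext ?_ ?_
    · funext c
      have h := N.message_comm u a b (q u) c
      simp only [step, Function.update_self]
      have h' : (N.message u a (q u) c : ℤ) + N.message u b ((N.proc u).t a (q u)) c =
        N.message u b (q u) c + N.message u a ((N.proc u).t b (q u)) c := by exact_mod_cast h
      linarith
    · simp only [step, Function.update_self, Function.update_idem]
      congr 1
      exact congrFun ((N.proc u).t_comm a b) (q u)
  · have hvu : v ≠ u := fun h => huv h.symm
    refine Prod.ext ?_ ?_
    · funext c
      simp only [step, Function.update_of_ne huv, Function.update_of_ne hvu]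
      ring
    · simp only [step, Function.update_of_ne huv, Function.update_of_ne hvu]
      exact Function.update_comm huv _ _ _

/-- The result of an execution does not depend on the order of the letters. -/
theorem exec_perm {w w' : List (Σ v, A v)} (h : w.Perm w')
    (s : ((Σ v, A v) → ℤ) × ((v : V) → Q v)) : N.exec w s = N.exec w' s := by
  unfold exec
  exact h.foldl_eq' (fun a _ b _ z => N.step_comm b a z) s

theorem exec_append (w w' : List (Σ v, A v)) (s : ((Σ v, A v) → ℤ) × ((v : V) → Q v)) :
    N.exec (w ++ w') s = N.exec w' (N.exec w s) := by
  simp [exec, List.foldl_append]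

theorem exec_cons (a : Σ v, A v) (w : List (Σ v, A v))
    (s : ((Σ v, A v) → ℤ) × ((v : V) → Q v)) : N.exec (a :: w) s = N.exec w (N.step a s) := rfl

theorem step_add (a : Σ v, A v) (x y : (Σ v, A v) → ℤ) (q : (v : V) → Q v) :
    N.step a (x + y, q) = ((N.step a (x, q)).1 + y, (N.step a (x, q)).2) := by
  refine Prod.ext ?_ rfl
  funext b
  simp only [step, Pi.add_apply]
  ring

theorem exec_add (w : List (Σ v, A v)) (x y : (Σ v, A v) → ℤ) (q : (v : V) → Q v) :
    N.exec w (x + y, q) = ((N.exec w (x, q)).1 + y, (N.exec w (x, q)).2) := by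
  induction w generalizing x q with
  | nil => rfl
  | cons a w ih => rw [exec_cons, exec_cons, step_add, ih]

theorem legal_append (w w' : List (Σ v, A v)) (s : ((Σ v, A v) → ℤ) × ((v : V) → Q v))
    (h : N.Legal w s) (h' : N.Legal w' (N.exec w s)) : N.Legal (w ++ w') s := by
  induction w generalizing s with
  | nil => exact h'
  | cons a w ih => exact ⟨h.1, ih _ h.2 h'⟩

theorem legal_add (w : List (Σ v, A v)) (x y : (Σ v, A v) → ℤ) (q : (v : V) → Q v)
    (hy : ∀ a, 0 ≤ y a) (h : N.Legal w (x, q)) : N.Legal w (x + y, q) := by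
  induction w generalizing x q with
  | nil => trivial
  | cons a w ih =>
    refine ⟨?_, ?_⟩
    · have h1 := h.1
      have h2 := hy a
      simp only [Pi.add_apply] at h1 ⊢
      linarith
    · rw [step_add]
      exact ih _ _ h.2

theorem step_fst_le {a b : Σ v, A v} (hab : b ≠ a) (s : ((Σ v, A v) → ℤ) × ((v : V) → Q v)) :
    s.1 b ≤ (N.step a s).1 b := by
  simp only [step, Pi.single_eq_of_ne hab]
  have : (0 : ℤ) ≤ N.message a.1 a.2 (s.2 a.1) b := Int.natCast_nonneg _
  linarith

theorem exec_nonneg (w : List (Σ v, A v)) (s : ((Σ v, A v) → ℤ) × ((v : V) → Q v))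
    (hs : ∀ a, 0 ≤ s.1 a) (h : N.Legal w s) (b : Σ v, A v) : 0 ≤ (N.exec w s).1 b := by
  induction w generalizing s with
  | nil => exact hs b
  | cons a w ih =>
    refine ih (N.step a s) (fun c => ?_) h.2
    by_cases hc : c = a
    · subst hc
      have h1 := h.1
      simp only [step, Pi.single_eq_same]
      have : (0 : ℤ) ≤ N.message c.1 c.2 (s.2 c.1) c := Int.natCast_nonneg _
      linarith
    · exact (hs c).trans (N.step_fst_le hc s)

theorem exists_perm_cons (w : List (Σ v, A v)) (s : ((Σ v, A v) → ℤ) × ((v : V) → Q v))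
    (a : Σ v, A v) (ha : 1 ≤ s.1 a) (h : N.Legal w s) (hc : N.Complete w s) :
    ∃ w', w.Perm (a :: w') ∧ N.Legal w' (N.step a s) := by
  induction w generalizing s with
  | nil =>
    have := hc a
    simp only [exec, List.foldl_nil] at this
    omega
  | cons b w ih =>
    by_cases hab : a = b
    · subst hab
      exact ⟨w, List.Perm.refl _, h.2⟩
    · obtain ⟨w', hp, hl⟩ := ih (N.step b s) (ha.trans (N.step_fst_le hab s)) h.2 hc
      refine ⟨b :: w', (hp.cons b).trans (List.Perm.swap a b w'), ?_, ?_⟩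
      · exact h.1.trans (N.step_fst_le (Ne.symm hab) s)
      · rw [step_comm]
        exact hl

/-- Any two complete legal executions agree up to the order of the letters. -/
theorem perm_of_legal_complete (w w' : List (Σ v, A v))
    (s : ((Σ v, A v) → ℤ) × ((v : V) → Q v)) (h : N.Legal w s) (hc : N.Complete w s)
    (h' : N.Legal w' s) (hc' : N.Complete w' s) : w.Perm w' := by
  induction w generalizing s w' with
  | nil =>
    cases w' with
    | nil => exact List.Perm.refl _
    | cons b w' =>
      have h1 := hc b
      have h2 := h'.1
      simp only [exec, List.foldl_nil] at h1
      omega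
  | cons a w ih =>
    obtain ⟨u, hp, hl⟩ := N.exists_perm_cons w' s a h.1 h' hc'
    have hu : N.Complete u (N.step a s) := by
      intro b
      rw [← exec_cons, ← N.exec_perm hp]
      exact hc' b
    exact ((ih u _ h.2 hc hl hu).cons a).trans hp.symm

/-! ### The global action and the critical group -/

variable {N}

/-- The final state `x ▷▷ q` of a complete legal execution for `x.q`. -/
noncomputable def globalAct (hN : N.HaltsOnAllInputs) (x : (Σ v, A v) → ℕ)
    (q : (v : V) → Q v) : (v : V) → Q v :=
  (N.exec (Classical.choose (hN x q)) (fun a => (x a : ℤ), q)).2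

/-- `x ▷▷ q` does not depend on the choice of the complete legal execution. -/
theorem globalAct_eq (hN : N.HaltsOnAllInputs) (x : (Σ v, A v) → ℕ) (q : (v : V) → Q v)
    (w : List (Σ v, A v)) (h : N.Legal w (fun a => (x a : ℤ), q))
    (hc : N.Complete w (fun a => (x a : ℤ), q)) :
    globalAct hN x q = (N.exec w (fun a => (x a : ℤ), q)).2 := by
  have hs := Classical.choose_spec (hN x q)
  unfold globalAct
  rw [N.exec_perm (N.perm_of_legal_complete _ w _ hs.1 hs.2 h hc)]

theorem globalAct_add (hN : N.HaltsOnAllInputs) (x y : (Σ v, A v) → ℕ) (q : (v : V) → Q v) :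
    globalAct hN (x + y) q = globalAct hN y (globalAct hN x q) := by
  obtain ⟨w, hw, hwc⟩ := hN x q
  have hx := globalAct_eq hN x q w hw hwc
  obtain ⟨u, hu, huc⟩ := hN y (globalAct hN x q)
  have hy := globalAct_eq hN y (globalAct hN x q) u hu huc
  have hxy : (fun a => (((x + y) a : ℕ) : ℤ)) =
      (fun a => (x a : ℤ)) + fun a => (y a : ℤ) := by
    funext a
    simp
  have he : N.exec w (fun a => (((x + y) a : ℕ) : ℤ), q) =
      (fun a => (y a : ℤ), globalAct hN x q) := by
    rw [hxy, exec_add]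
    refine Prod.ext ?_ hx.symm
    funext a
    have h1 := hwc a
    have h2 := N.exec_nonneg w (fun a => (x a : ℤ), q) (fun a => Int.natCast_nonneg _) hw a
    simp only [Pi.add_apply]
    omega
  rw [hy, ← he, ← exec_append]
  refine globalAct_eq hN (x + y) q (w ++ u) ?_ ?_
  · refine N.legal_append _ _ _ ?_ (by rw [he]; exact hu)
    rw [hxy]
    exact N.legal_add _ _ _ _ (fun a => Int.natCast_nonneg _) hw
  · intro a
    rw [exec_append, he]
    exact huc a

/-- The map `τ_a`, `q ↦ 1_a ▷▷ q`. -/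
noncomputable def tau (hN : N.HaltsOnAllInputs) (a : Σ v, A v) : Function.End ((v : V) → Q v) :=
  fun q => globalAct hN (Pi.single a 1) q

/-- The global monoid, generated by the maps `τ_a` inside `End Q`. -/
def globalMonoid (hN : N.HaltsOnAllInputs) : Submonoid (Function.End ((v : V) → Q v)) :=
  Submonoid.closure (Set.range (tau hN))

noncomputable instance (hN : N.HaltsOnAllInputs) : CommMonoid (globalMonoid hN) :=
  { (inferInstance : Monoid (globalMonoid hN)) with
    mul_comm := mul_comm_of_closure (by
      rintro _ ⟨a, rfl⟩ _ ⟨b, rfl⟩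
      funext q
      change globalAct hN _ (globalAct hN _ q) = globalAct hN _ (globalAct hN _ q)
      rw [← globalAct_add, ← globalAct_add, add_comm]) }

variable [Fintype V] [∀ v, Fintype (A v)] [∀ v, Finite (Q v)]

/-- The critical group `e M`, where `M` is the global monoid and `e` its minimal idempotent. -/
abbrev Crit (hN : N.HaltsOnAllInputs) : Type _ := MinGroup (globalMonoid hN)

/-- The natural map `ℤ^A → Crit N`, sending `1_a` to `e τ_a`. -/
noncomputable def toCrit (hN : N.HaltsOnAllInputs) :
    ((Σ v, A v) → ℤ) →+ Additive (Crit hN) :=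
  naturalMap fun a => (⟨tau hN a, Submonoid.subset_closure ⟨a, rfl⟩⟩ : globalMonoid hN)

end Executions

/-! ### Total kernel, production map and Laplacian -/

section Laplacian

variable {V : Type*} [Fintype V] [DecidableEq V] {G : Digraph V} {A Q : V → Type*}
  [∀ v, Fintype (A v)] [∀ v, DecidableEq (A v)] [∀ v, Finite (Q v)] (N : Network G A Q)

/-- A network is irreducible if each of its processors is. -/
def IsIrreducible : Prop := ∀ v, (N.proc v).IsIrreducible

/-- The total kernel `K = ∏ K_v`. -/
noncomputable def totalKernel : AddSubgroup ((Σ v, A v) → ℤ) where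
  carrier := {x | ∀ v, (fun a => x ⟨v, a⟩) ∈ (N.proc v).kernel}
  zero_mem' := fun v => (N.proc v).kernel.zero_mem
  add_mem' := fun hx hy v => (N.proc v).kernel.add_mem (hx v) (hy v)
  neg_mem' := fun hx v => (N.proc v).kernel.neg_mem (hx v)

/-- The locally recurrent states: `q v ∈ e_v Q_v` for all `v`. -/
def locallyRecurrent : Set ((v : V) → Q v) := {q | ∀ v, q v ∈ (N.proc v).recurrent}

theorem exists_smul_mem_totalKernel :
    ∃ n : ℕ, 0 < n ∧ ∀ x : (Σ v, A v) → ℤ, n • x ∈ N.totalKernel := by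
  choose n hn h using fun v => (N.proc v).exists_smul_mem_kernel
  refine ⟨∏ v, n v, Finset.prod_pos fun v _ => hn v, fun x v => ?_⟩
  obtain ⟨c, hc⟩ := Finset.dvd_prod_of_mem n (Finset.mem_univ v)
  rw [hc]
  have := h v (c • fun a => x ⟨v, a⟩)
  rwa [← mul_smul] at this

/-- An irreducible network has locally recurrent states. -/
theorem locallyRecurrent_nonempty (h : N.IsIrreducible) : N.locallyRecurrent.Nonempty :=
  ⟨fun v => minIdempotent (N.proc v).monoid • (h v).1.some, fun v => ⟨(h v).1.some, rfl⟩⟩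

/-- A word containing each letter `a` exactly `k a` times. -/
noncomputable def wordOf (k : (Σ v, A v) → ℕ) : List (Σ v, A v) :=
  Finset.univ.toList.flatMap fun a => List.replicate (k a) a

theorem count_wordOf (k : (Σ v, A v) → ℕ) (a : Σ v, A v) : (wordOf k).count a = k a := by
  unfold wordOf
  rw [List.count_flatMap, Finset.sum_map_toList]
  simp [List.count_replicate]

/-- The local action `k ▷ q`: the result of adding the letters `k` to `0.q` and processing
exactly these letters. -/
noncomputable def localAct (k : (Σ v, A v) → ℕ) (q : (v : V) → Q v) :
    ((Σ v, A v) → ℤ) × ((v : V) → Q v) :=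
  N.exec (wordOf k) (fun a => (k a : ℤ), q)

variable {N}

theorem exec_snd (w : List (Σ v, A v)) (x : (Σ v, A v) → ℤ) (q : (v : V) → Q v)
    (hq : q ∈ N.locallyRecurrent) (v : V) :
    (N.exec w (x, q)).2 v =
      (((N.proc v).intAction (fun a => (w.count ⟨v, a⟩ : ℤ))).toMul ⟨q v, hq v⟩).1 := by
  induction w generalizing x q with
  | nil =>
    have h0 : (fun a : A v => ((([] : List (Σ v, A v)).count ⟨v, a⟩ : ℕ) : ℤ)) = 0 := by
      funext a
      simp
    rw [h0, map_zero]
    rfl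
  | cons b w ih =>
    obtain ⟨u, b⟩ := b
    have hstep : ∀ v', (N.step ⟨u, b⟩ (x, q)).2 v' ∈ (N.proc v').recurrent ∧
        (N.step ⟨u, b⟩ (x, q)).2 v' =
          (((N.proc v').intAction (fun a => (([⟨u, b⟩] : List (Σ v, A v)).count ⟨v', a⟩ : ℤ))).toMul
            ⟨q v', hq v'⟩).1 := by
      intro v'
      have key : (N.step ⟨u, b⟩ (x, q)).2 v' =
          (((N.proc v').intAction (fun a => (([⟨u, b⟩] : List (Σ v, A v)).count ⟨v', a⟩ : ℤ))).toMul
            ⟨q v', hq v'⟩).1 := by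
        by_cases hv : v' = u
        · subst hv
          have h1 : (fun a => (([⟨v', b⟩] : List (Σ v, A v)).count ⟨v', a⟩ : ℤ)) =
              Pi.single b 1 := by
            funext a
            by_cases hab : a = b
            · subst hab
              simp
            · simp [hab, Ne.symm hab]
          rw [h1, Processor.intAction_single]
          simp [step]
        · have h1 : (fun a => (([⟨u, b⟩] : List (Σ v, A v)).count ⟨v', a⟩ : ℤ)) = 0 := by
            funext a
            have : ¬ (u = v') := fun h => hv h.symm
            simp [this]
          rw [h1, map_zero]
          simp [step, Function.update_of_ne hv]
      refine ⟨?_, key⟩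
      rw [key]
      exact Subtype.prop _
    have hsplit : (fun a => (((⟨u, b⟩ :: w : List (Σ v, A v)).count ⟨v, a⟩ : ℕ) : ℤ)) =
        (fun a => ((w.count ⟨v, a⟩ : ℕ) : ℤ)) +
          fun a => (([⟨u, b⟩] : List (Σ v, A v)).count ⟨v, a⟩ : ℤ) := by
      funext a
      simp [List.count_cons]
    rw [exec_cons, hsplit, map_add]
    have := ih (N.step ⟨u, b⟩ (x, q)).1 (N.step ⟨u, b⟩ (x, q)).2 (fun v' => (hstep v').1)
    rw [Prod.mk.eta] at this
    rw [this]
    have he : (⟨(N.step ⟨u, b⟩ (x, q)).2 v, (hstep v).1⟩ : recurrentSet (N.proc v).monoid (Q v)) =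
        ((N.proc v).intAction
          (fun a => (([⟨u, b⟩] : List (Σ v, A v)).count ⟨v, a⟩ : ℤ))).toMul ⟨q v, hq v⟩ :=
      Subtype.ext (hstep v).2
    rw [he]
    rfl

/-- Letters in `K ∩ ℕ^A` return each locally recurrent state to itself. -/
theorem localAct_snd {q : (v : V) → Q v} (hq : q ∈ N.locallyRecurrent) {k : (Σ v, A v) → ℕ}
    (hk : (fun a => (k a : ℤ)) ∈ N.totalKernel) : (N.localAct k q).2 = q := by
  funext v
  unfold localAct
  rw [exec_snd _ _ _ hq]
  simp only [count_wordOf]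
  have h := hk v
  rw [Processor.kernel, AddMonoidHom.mem_ker] at h
  rw [h]
  rfl

theorem localAct_add {q : (v : V) → Q v} (hq : q ∈ N.locallyRecurrent) {k l : (Σ v, A v) → ℕ}
    (hk : (fun a => (k a : ℤ)) ∈ N.totalKernel) :
    (N.localAct (k + l) q).1 = (N.localAct k q).1 + (N.localAct l q).1 := by
  have hp : (wordOf (k + l)).Perm (wordOf k ++ wordOf l) := by
    rw [List.perm_iff_count]
    intro a
    simp [List.count_append, count_wordOf]
  have hkl : (fun a => (((k + l) a : ℕ) : ℤ)) = (fun a => (k a : ℤ)) + fun a => (l a : ℤ) := by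
    funext a
    simp
  have h2 : (N.exec (wordOf k) (fun a => (k a : ℤ), q)).2 = q := localAct_snd hq hk
  unfold localAct
  rw [N.exec_perm hp, exec_append, hkl, exec_add, h2,
    add_comm (N.exec (wordOf k) (fun a => (k a : ℤ), q)).1, exec_add, add_comm]

theorem exists_extension {ι H : Type*} [AddCommGroup H] (K : AddSubgroup (ι → ℤ)) (n : ℕ)
    (hn : 0 < n) (hK : ∀ x : ι → ℤ, n • x ∈ K) (f : (ι → ℕ) → H)
    (hf : ∀ k l : ι → ℕ, (fun i => (k i : ℤ)) ∈ K → (fun i => (l i : ℤ)) ∈ K →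
      f (k + l) = f k + f l) :
    ∃ P : K →+ H, ∀ (k : ι → ℕ) (hk : (fun i => (k i : ℤ)) ∈ K), P ⟨_, hk⟩ = f k := by
  have hsplit : ∀ k : K, ∃ p m : ι → ℕ, (fun i => (p i : ℤ)) ∈ K ∧ (fun i => (m i : ℤ)) ∈ K ∧
      ∀ i, (k.1 i : ℤ) = p i - m i := by
    intro k
    have hm : (fun i => ((n * (-(k.1 i)).toNat : ℕ) : ℤ)) ∈ K := by
      convert hK (fun i => ((-(k.1 i)).toNat : ℤ)) using 1
      funext i
      simp
    have hpos : ∀ i, (((k.1 i + (n * (-(k.1 i)).toNat : ℕ)).toNat : ℕ) : ℤ) =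
        k.1 i + (n * (-(k.1 i)).toNat : ℕ) := by
      intro i
      apply Int.toNat_of_nonneg
      have h1 : (-(k.1 i)).toNat ≤ n * (-(k.1 i)).toNat := Nat.le_mul_of_pos_left _ hn
      have h2 : -(k.1 i) ≤ (-(k.1 i)).toNat := Int.self_le_toNat _
      have h3 : ((-(k.1 i)).toNat : ℤ) ≤ (n * (-(k.1 i)).toNat : ℕ) := by exact_mod_cast h1
      linarith
    refine ⟨fun i => (k.1 i + (n * (-(k.1 i)).toNat : ℕ)).toNat,
      fun i => n * (-(k.1 i)).toNat, ?_, hm, ?_⟩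
    · convert K.add_mem k.2 hm using 1
      funext i
      exact hpos i
    · intro i
      rw [hpos i]
      ring
  choose p m hp hm hkpm using hsplit
  have hwd : ∀ a b c d : ι → ℕ, (fun i => (a i : ℤ)) ∈ K → (fun i => (b i : ℤ)) ∈ K →
      (fun i => (c i : ℤ)) ∈ K → (fun i => (d i : ℤ)) ∈ K →
      (∀ i, (a i : ℤ) - b i = c i - d i) → f a - f b = f c - f d := by
    intro a b c d ha hb hc hd h
    have h1 : a + d = c + b := by
      funext i
      have := h i
      simp only [Pi.add_apply]
      omega
    rw [sub_eq_sub_iff_add_eq_add, ← hf a d ha hd, h1, hf c b hc hb]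
  have hadd : ∀ a b : ι → ℕ, (fun i => (a i : ℤ)) ∈ K → (fun i => (b i : ℤ)) ∈ K →
      (fun i => ((a + b) i : ℤ)) ∈ K := by
    intro a b ha hb
    convert K.add_mem ha hb using 1
    funext i
    simp
  have h00 : (fun i => (((0 : ι → ℕ) i : ℕ) : ℤ)) ∈ K := by
    convert K.zero_mem using 1
    funext i
    simp
  have hf0 : f 0 = 0 := by
    have := hf 0 0 h00 h00
    rw [add_zero] at this
    exact left_eq_add.mp this
  refine ⟨AddMonoidHom.mk' (fun k => f (p k) - f (m k)) ?_, ?_⟩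
  · intro k l
    have h1 : f (p k) - f (m k) + (f (p l) - f (m l)) = f (p k + p l) - f (m k + m l) := by
      rw [hf _ _ (hp k) (hp l), hf _ _ (hm k) (hm l)]
      abel
    rw [h1]
    refine hwd _ _ _ _ (hp _) (hm _) (hadd _ _ (hp k) (hp l)) (hadd _ _ (hm k) (hm l)) ?_
    intro i
    have e1 := hkpm (k + l) i
    have e2 := hkpm k i
    have e3 := hkpm l i
    have e4 : (k + l).1 i = k.1 i + l.1 i := rfl
    simp only [Pi.add_apply]
    push_cast
    linarith
  · intro k hk
    change f (p ⟨_, hk⟩) - f (m ⟨_, hk⟩) = f k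
    rw [hwd _ _ k 0 (hp _) (hm _) hk h00, hf0, sub_zero]
    intro i
    have := hkpm ⟨_, hk⟩ i
    simp only at this
    rw [← this]
    simp

theorem exists_productionMap {q : (v : V) → Q v} (hq : q ∈ N.locallyRecurrent) :
    ∃ P : N.totalKernel →+ ((Σ v, A v) → ℤ),
      ∀ (k : (Σ v, A v) → ℕ) (hk : (fun a => (k a : ℤ)) ∈ N.totalKernel),
        N.localAct k q = (P ⟨_, hk⟩, q) := by
  obtain ⟨n, hn, hK⟩ := N.exists_smul_mem_totalKernel
  obtain ⟨P, hP⟩ := exists_extension N.totalKernel n hn hK (fun k => (N.localAct k q).1)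
    (fun k l hk _ => localAct_add hq hk)
  exact ⟨P, fun k hk => Prod.ext (hP k hk).symm (localAct_snd hq hk)⟩

/-- The production map `P_q : K → ℤ^A` at a locally recurrent state `q`: the group homomorphism
with `k ▷ q = P_q(k).q` for all `k ∈ K ∩ ℕ^A`. (It is unique because `K` is generated by
`K ∩ ℕ^A`.) -/
noncomputable def productionMap {q : (v : V) → Q v} (hq : q ∈ N.locallyRecurrent) :
    N.totalKernel →+ ((Σ v, A v) → ℤ) :=
  Classical.choose (exists_productionMap hq)

theorem productionMap_spec {q : (v : V) → Q v} (hq : q ∈ N.locallyRecurrent)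
    (k : (Σ v, A v) → ℕ) (hk : (fun a => (k a : ℤ)) ∈ N.totalKernel) :
    N.localAct k q = (productionMap hq ⟨_, hk⟩, q) :=
  Classical.choose_spec (exists_productionMap hq) k hk

variable (N)

/-- The reset number `r_a = min {m ≥ 1 : m 1_a ∈ K}`. -/
noncomputable def resetNumber (a : Σ v, A v) : ℕ :=
  sInf {m : ℕ | 1 ≤ m ∧ (m : ℤ) • (Pi.single a 1 : (Σ v, A v) → ℤ) ∈ N.totalKernel}

theorem resetNumber_spec (a : Σ v, A v) : 1 ≤ N.resetNumber a ∧
    (N.resetNumber a : ℤ) • (Pi.single a 1 : (Σ v, A v) → ℤ) ∈ N.totalKernel := by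
  obtain ⟨n, hn, hK⟩ := N.exists_smul_mem_totalKernel
  refine Nat.sInf_mem (s := {m : ℕ | 1 ≤ m ∧
    (m : ℤ) • (Pi.single a 1 : (Σ v, A v) → ℤ) ∈ N.totalKernel}) ⟨n, hn, ?_⟩
  rw [natCast_zsmul]
  exact hK _

/-- A network is rectangular if `K = ∏ r_a ℤ`. -/
def IsRectangular : Prop :=
  ∀ x : (Σ v, A v) → ℤ, x ∈ N.totalKernel ↔ ∀ a, (N.resetNumber a : ℤ) ∣ x a

variable {N}

/-- The production matrix: the rational matrix whose column `a` is `P(1_a) = (1/r_a) P(r_a 1_a)`,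
that is, the matrix of the `ℚ`-linear extension of the production map `K → ℤ^A`. -/
noncomputable def productionMatrix {q : (v : V) → Q v} (hq : q ∈ N.locallyRecurrent) :
    Matrix (Σ v, A v) (Σ v, A v) ℚ :=
  Matrix.of fun b a =>
    (1 / (N.resetNumber a : ℚ)) * (productionMap hq ⟨_, (N.resetNumber_spec a).2⟩ b : ℚ)

/-- The production matrix agrees with the production map on `K`. -/
theorem productionMatrix_mulVec {q : (v : V) → Q v} (hq : q ∈ N.locallyRecurrent)
    (k : N.totalKernel) :
    (productionMatrix hq).mulVec (fun a => (k.1 a : ℚ)) = fun b => (productionMap hq k b : ℚ) := by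
  have hr : ∀ a, (N.resetNumber a : ℚ) ≠ 0 := fun a => by
    have := (N.resetNumber_spec a).1
    positivity
  obtain ⟨c, hc⟩ : ∃ c : (Σ v, A v) → ℤ,
      ∀ a, (∏ a, (N.resetNumber a : ℤ)) = N.resetNumber a * c a :=
    ⟨_, fun a => Classical.choose_spec
      (Finset.dvd_prod_of_mem (fun a => (N.resetNumber a : ℤ)) (Finset.mem_univ a))⟩
  have hR : (∏ a, (N.resetNumber a : ℚ)) ≠ 0 := Finset.prod_ne_zero_iff.mpr fun a _ => hr a
  have hsum : (∏ a, (N.resetNumber a : ℤ)) • k =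
      ∑ a, (c a * k.1 a) • (⟨_, (N.resetNumber_spec a).2⟩ : N.totalKernel) := by
    refine Subtype.ext ?_
    funext b
    simp only [AddSubgroup.coe_zsmul, AddSubgroup.val_finsetSum, Finset.sum_apply, Pi.smul_apply,
      Pi.single_apply, smul_eq_mul]
    rw [Finset.sum_eq_single b]
    · rw [hc b]
      simp
      ring
    · intro a _ hab
      simp [hab.symm]
    · simp
  funext b
  have hP := congrFun (congrArg (productionMap hq) hsum) b
  rw [map_zsmul, map_sum] at hP
  simp only [map_zsmul, Pi.smul_apply, Finset.sum_apply, smul_eq_mul] at hP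
  have hP' := congrArg (fun z : ℤ => (z : ℚ)) hP
  push_cast at hP'
  apply mul_left_cancel₀ hR
  rw [hP', Matrix.mulVec, dotProduct, Finset.mul_sum]
  refine Finset.sum_congr rfl fun a _ => ?_
  have hca : (∏ a, (N.resetNumber a : ℚ)) = N.resetNumber a * c a := by exact_mod_cast hc a
  rw [hca]
  simp only [productionMatrix, Matrix.of_apply]
  have := hr a
  field_simp

/-- The Laplacian `L = (I - P) D`, where `D` is diagonal with entries `r_a`. -/
noncomputable def laplacian {q : (v : V) → Q v} (hq : q ∈ N.locallyRecurrent) :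
    Matrix (Σ v, A v) (Σ v, A v) ℚ :=
  (1 - productionMatrix hq) * Matrix.diagonal fun a => (N.resetNumber a : ℚ)

/-- The subgroup `L ℤ^A` of `ℤ^A`. -/
noncomputable def laplacianImage {q : (v : V) → Q v} (hq : q ∈ N.locallyRecurrent) :
    AddSubgroup ((Σ v, A v) → ℤ) where
  carrier := {x | ∃ y : (Σ v, A v) → ℤ,
    (fun a => (x a : ℚ)) = (laplacian hq).mulVec fun a => (y a : ℚ)}
  zero_mem' := ⟨0, by
    have h : (fun a : Σ v, A v => (((0 : (Σ v, A v) → ℤ) a : ℤ) : ℚ)) = 0 := by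
      funext a
      simp
    rw [h, Matrix.mulVec_zero]⟩
  add_mem' := by
    rintro x x' ⟨y, hy⟩ ⟨y', hy'⟩
    refine ⟨y + y', ?_⟩
    have h : ∀ z z' : (Σ v, A v) → ℤ, (fun a => (((z + z') a : ℤ) : ℚ)) =
        (fun a => (z a : ℚ)) + fun a => (z' a : ℚ) := by
      intro z z'
      funext a
      simp
    rw [h, h, Matrix.mulVec_add, hy, hy']
  neg_mem' := by
    rintro x ⟨y, hy⟩
    refine ⟨-y, ?_⟩
    have h : ∀ z : (Σ v, A v) → ℤ, (fun a => (((-z) a : ℤ) : ℚ)) = -fun a => (z a : ℚ) := by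
      intro z
      funext a
      simp
    rw [h, h, Matrix.mulVec_neg, hy]

/-- `L` maps `ℤ^A` into `ℤ^A`. -/
theorem laplacian_mulVec_integral {q : (v : V) → Q v} (hq : q ∈ N.locallyRecurrent)
    (y : (Σ v, A v) → ℤ) : ∃ x : (Σ v, A v) → ℤ,
      (fun a => (x a : ℚ)) = (laplacian hq).mulVec fun a => (y a : ℚ) := by
  have hk : (fun a => (N.resetNumber a : ℤ) * y a) ∈ N.totalKernel := by
    have h : (fun a => (N.resetNumber a : ℤ) * y a) =
        ∑ a, y a • ((N.resetNumber a : ℤ) • (Pi.single a 1 : (Σ v, A v) → ℤ)) := by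
      funext b
      simp only [Finset.sum_apply, Pi.smul_apply, Pi.single_apply, smul_eq_mul]
      rw [Finset.sum_eq_single b]
      · simp
        ring
      · intro a _ hab
        simp [hab.symm]
      · simp
    rw [h]
    exact N.totalKernel.sum_mem fun a _ => N.totalKernel.zsmul_mem (N.resetNumber_spec a).2 _
  refine ⟨fun a => N.resetNumber a * y a - productionMap hq ⟨_, hk⟩ a, ?_⟩
  have hd : (Matrix.diagonal fun a => (N.resetNumber a : ℚ)).mulVec (fun a => (y a : ℚ)) =
      fun a => (((N.resetNumber a : ℤ) * y a : ℤ) : ℚ) := by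
    funext a
    simp [Matrix.mulVec_diagonal]
  have hp := productionMatrix_mulVec hq ⟨_, hk⟩
  rw [laplacian, ← Matrix.mulVec_mulVec, hd, Matrix.sub_mulVec, Matrix.one_mulVec, hp]
  funext a
  simp

end Laplacian

end Network

end AbelianNet

/-!
The kernel of the natural map is `(I - P)K`. Processing `k ∈ K ∩ ℕ^A` from `k.q` is legal, leaves
`q` fixed and turns `k` into `P k`, so `k` and `P k` act alike on recurrent states. Conversely, let
`x` and `y` act alike on a recurrent state `q`, and let `w` and `u` be words executing `x.q` and
`y.q` down to `0`. They end in the same state, so by irreducibility a common word `c` leads back to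
`q`; the letter counts of `w ++ c` and `u ++ c` lie in `K`, and their difference `k` satisfies
`x - y = k - P k`. As `D ℤ^A = ∏ r_a ℤ ⊆ K`, the image of `L` is contained in `(I - P)K`, and is
equal to it when `K = ∏ r_a ℤ`.
-/

namespace AbelianNet

section Vectors

variable {ι : Type*}

/-- The inclusion `ℕ^ι → ℤ^ι`. -/
def intVec : (ι → ℕ) →+ (ι → ℤ) := (Nat.castAddMonoidHom ℤ).compLeft ι

theorem intVec_apply (k : ι → ℕ) (i : ι) : intVec k i = k i := rfl

theorem intVec_nonneg (k : ι → ℕ) : 0 ≤ intVec k := fun _ => Int.natCast_nonneg _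

theorem exists_intVec_eq {x : ι → ℤ} (hx : 0 ≤ x) : ∃ k : ι → ℕ, intVec k = x :=
  ⟨fun i => (x i).toNat, funext fun i => Int.toNat_of_nonneg (hx i)⟩

theorem exists_intVec_sub_intVec_eq (x : ι → ℤ) : ∃ k l : ι → ℕ, intVec k - intVec l = x :=
  ⟨fun i => (x i).toNat, fun i => (-x i).toNat, funext fun i => Int.toNat_sub_toNat_neg (x i)⟩

theorem intVec_single_one [DecidableEq ι] (i : ι) : intVec (Pi.single i 1) = Pi.single i 1 := by
  ext j
  simp [intVec_apply, Pi.single_apply]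

/-- The vector counting how often each letter occurs in a word. -/
def letterCount [DecidableEq ι] (w : List ι) : ι → ℕ := fun i => w.count i

variable [DecidableEq ι]

theorem letterCount_nil : letterCount ([] : List ι) = 0 := rfl

theorem letterCount_cons (i : ι) (w : List ι) :
    letterCount (i :: w) = Pi.single i 1 + letterCount w := by
  ext j
  rw [Pi.add_apply, add_comm, Pi.single_apply]
  simp only [letterCount, List.count_cons, beq_iff_eq, eq_comm (a := i)]

end Vectors

/-- The nonnegative elements generate `K`, because `k = (k + n • |k|) - n • |k|`. -/
theorem addMonoidHom_ext_of_nonneg {G H : Type*} [AddCommGroup G] [Lattice G]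
    [IsOrderedAddMonoid G] [AddGroup H] {K : AddSubgroup G}
    (hK : ∃ n : ℕ, 0 < n ∧ ∀ x : G, n • x ∈ K) {f g : K →+ H}
    (hfg : ∀ k : K, 0 ≤ k.1 → f k = g k) : f = g := by
  obtain ⟨n, hn, hK⟩ := hK
  ext k
  let m : K := ⟨n • |k.1|, hK _⟩
  have hm : |k.1| ≤ m.1 := le_self_nsmul (abs_nonneg _) hn.ne'
  have hkm : 0 ≤ (k + m).1 := neg_le_iff_add_nonneg'.mp ((neg_le_abs k.1).trans hm)
  rw [← add_sub_cancel_right k m, map_sub, map_sub, hfg _ hkm, hfg m ((abs_nonneg _).trans hm)]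

section Monomials

variable {M I : Type*} [CommMonoid M] [Fintype I]

/-- The monomial `g^k = ∏ (g a)^(k a)` in a family `g` of elements of a commutative monoid. -/
def monomial (g : I → M) (k : I → ℕ) : M := ∏ a, g a ^ k a

theorem monomial_zero (g : I → M) : monomial g 0 = 1 := by simp [monomial]

theorem monomial_single_one [DecidableEq I] (g : I → M) (a : I) :
    monomial g (Pi.single a 1) = g a := by
  simp [monomial, Pi.single_apply]

theorem monomial_add (g : I → M) (k l : I → ℕ) :
    monomial g (k + l) = monomial g k * monomial g l := by
  simp only [monomial, Pi.add_apply, pow_add, Finset.prod_mul_distrib]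

theorem monomial_dvd_monomial (g : I → M) {k l : I → ℕ} (hkl : k ≤ l) :
    monomial g k ∣ monomial g l :=
  Finset.prod_dvd_prod_of_dvd _ _ fun a _ => pow_dvd_pow _ (hkl a)

theorem exists_monomial_eq {g : I → M} (hg : Submonoid.closure (Set.range g) = ⊤) (m : M) :
    ∃ k : I → ℕ, monomial g k = m := by
  obtain ⟨k, hk⟩ := Submonoid.exists_of_mem_closure_range g m (hg ▸ Submonoid.mem_top m)
  exact ⟨k, hk.symm⟩

end Monomials

theorem closure_range_restrict_eq_top {N ι : Type*} [Monoid N] (f : ι → N) :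
    Submonoid.closure (Set.range fun i =>
      (⟨f i, Submonoid.subset_closure ⟨i, rfl⟩⟩ : Submonoid.closure (Set.range f))) = ⊤ := by
  rw [← Submonoid.closure_closure_coe_preimage]
  congr 1
  ext ⟨x, hx⟩
  simp

section MinimalIdempotent

variable {M X : Type*} [CommMonoid M] [Finite M]

/-- The projection `m ↦ e m` of a finite commutative monoid `M` onto the group `e M`, as a
homomorphism. -/
noncomputable def toMinGroupHom (M : Type*) [CommMonoid M] [Finite M] : M →* MinGroup M where
  toFun := toMinGroup
  map_one' := Subtype.ext (mul_one _)
  map_mul' m m' := Subtype.ext <| by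
    change minIdempotent M * (m * m') = (minIdempotent M * m) * (minIdempotent M * m')
    rw [mul_mul_mul_comm, minIdempotent_mul_self]

theorem toMinGroup_coe (g : MinGroup M) : toMinGroup g.1 = g :=
  Subtype.ext g.minIdempotent_mul

theorem naturalMap_intVec {I : Type*} [Fintype I] (g : I → M) (k : I → ℕ) :
    naturalMap g (intVec k) = Additive.ofMul (toMinGroup (monomial g k)) := by
  change ∑ a, (k a : ℤ) • Additive.ofMul (toMinGroupHom M (g a)) =
    Additive.ofMul (toMinGroupHom M (monomial g k))
  simp only [monomial, map_prod, map_pow, ofMul_prod, ofMul_pow, natCast_zsmul]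

theorem naturalMap_surjective {I : Type*} [Fintype I] {g : I → M}
    (hg : Submonoid.closure (Set.range g) = ⊤) : Function.Surjective (naturalMap g) := by
  intro x
  obtain ⟨k, hk⟩ := exists_monomial_eq hg x.toMul.1
  refine ⟨intVec k, ?_⟩
  rw [naturalMap_intVec, hk, toMinGroup_coe, ofMul_toMul]

variable [MulAction M X]

theorem exists_smul_eq_of_mem_recurrentSet (m : M) {x : X} (hx : x ∈ recurrentSet M X) :
    ∃ y : X, m • y = x := by
  obtain ⟨c, hc⟩ := exists_mul_eq_minIdempotent m
  exact ⟨c • x, by rw [← mul_smul, hc, minIdempotent_smul hx]⟩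

theorem smul_mem_recurrentSet_of_dvd {m : M} (hm : minIdempotent M ∣ m) (x : X) :
    m • x ∈ recurrentSet M X := by
  obtain ⟨c, rfl⟩ := hm
  exact ⟨c • x, (mul_smul _ _ _).symm⟩

theorem toMinGroup_eq_iff_forall_smul_eq [FaithfulSMul M X] {m l : M} :
    toMinGroup m = toMinGroup l ↔ ∀ x ∈ recurrentSet M X, m • x = l • x := by
  refine ⟨fun h x hx => ?_, fun h => Subtype.ext ?_⟩
  · rw [← toMinGroup_smul m ⟨x, hx⟩, h, toMinGroup_smul]
  · refine eq_of_smul_eq_smul (α := X) fun x => ?_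
    change (minIdempotent M * m) • x = (minIdempotent M * l) • x
    rw [mul_comm, mul_comm _ l, mul_smul, mul_smul, h _ ⟨x, rfl⟩]

theorem IsIrreducibleAction.exists_smul_eq (h : IsIrreducibleAction M X) (x : X) {x' : X}
    (hx' : x' ∈ recurrentSet M X) : ∃ m : M, m • x = x' := by
  obtain ⟨m, m', hm⟩ := h.2 x x'
  obtain ⟨c, hc⟩ := exists_mul_eq_minIdempotent m'
  exact ⟨c * m, by rw [mul_smul, hm, ← mul_smul, mul_comm, hc, minIdempotent_smul hx']⟩

/-- A commutative group acting transitively acts freely modulo the kernel of the action. -/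
theorem IsIrreducibleAction.smul_eq_self_of_smul_eq_self (h : IsIrreducibleAction M X)
    {g : MinGroup M} {x : recurrentSet M X} (hx : g • x = x) (y : recurrentSet M X) :
    g • y = y := by
  obtain ⟨m, hm⟩ := h.exists_smul_eq x.1 y.2
  have hmx : toMinGroup m • x = y := Subtype.ext ((toMinGroup_smul m x).trans hm)
  rw [← hmx, smul_smul, mul_comm, mul_smul, hx]

end MinimalIdempotent

namespace Processor

variable {I Q U : Type*} {B : U → Type*} {p : Processor I Q B}

theorem closure_range_gen (p : Processor I Q B) :
    Submonoid.closure (Set.range p.gen) = ⊤ :=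
  closure_range_restrict_eq_top p.t

theorem IsIrreducible.mem_kernel [Fintype I] [Finite Q] (hp : p.IsIrreducible) {x : I → ℤ}
    {q : recurrentSet p.monoid Q} (hq : (p.intAction x).toMul q = q) : x ∈ p.kernel := by
  rw [kernel, AddMonoidHom.mem_ker]
  exact Additive.toMul.injective (Equiv.ext fun q' =>
    IsIrreducibleAction.smul_eq_self_of_smul_eq_self hp (g := (naturalMap p.gen x).toMul) hq q')

end Processor

namespace Network

section Executions

variable {V : Type*} [DecidableEq V] {G : Digraph V} {A Q : V → Type*} [∀ v, DecidableEq (A v)]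

/-- The net change in the vector of waiting letters when the word `w` is executed in state `q`;
it does not depend on the vector of waiting letters itself. -/
noncomputable def netChange (N : Network G A Q) (w : List (Σ v, A v)) (q : (v : V) → Q v) :
    (Σ v, A v) → ℤ :=
  (N.exec w (0, q)).1

/-- The state reached when the word `w` is executed in state `q`. -/
noncomputable def finalState (N : Network G A Q) (w : List (Σ v, A v)) (q : (v : V) → Q v) :
    (v : V) → Q v :=
  (N.exec w (0, q)).2

variable (N : Network G A Q)

theorem exec_eq (w : List (Σ v, A v)) (x : (Σ v, A v) → ℤ) (q : (v : V) → Q v) :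
    N.exec w (x, q) = (x + N.netChange w q, N.finalState w q) := by
  rw [← zero_add x, exec_add, zero_add, add_comm x]
  rfl

theorem exec_append_eq (w u : List (Σ v, A v)) (q : (v : V) → Q v) :
    N.exec (w ++ u) (0, q) =
      (N.netChange w q + N.netChange u (N.finalState w q),
        N.finalState u (N.finalState w q)) := by
  rw [exec_append, exec_eq, exec_eq, zero_add]

theorem netChange_append (w u : List (Σ v, A v)) (q : (v : V) → Q v) :
    N.netChange (w ++ u) q = N.netChange w q + N.netChange u (N.finalState w q) := by
  rw [netChange, exec_append_eq]

theorem finalState_append (w u : List (Σ v, A v)) (q : (v : V) → Q v) :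
    N.finalState (w ++ u) q = N.finalState u (N.finalState w q) := by
  rw [finalState, exec_append_eq]

theorem netChange_cons (a : Σ v, A v) (w : List (Σ v, A v)) (q : (v : V) → Q v) :
    N.netChange (a :: w) q = N.netChange [a] q + N.netChange w (N.finalState [a] q) :=
  N.netChange_append [a] w q

theorem finalState_cons (a : Σ v, A v) (w : List (Σ v, A v)) (q : (v : V) → Q v) :
    N.finalState (a :: w) q = N.finalState w (N.finalState [a] q) :=
  N.finalState_append [a] w q

theorem neg_single_le_netChange_singleton (a : Σ v, A v) (q : (v : V) → Q v) :
    -Pi.single a 1 ≤ N.netChange [a] q := by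
  intro b
  have hmessage : (0 : ℤ) ≤ N.message a.1 a.2 (q a.1) b := Int.natCast_nonneg _
  change _ ≤ 0 - (Pi.single a 1 : (Σ v, A v) → ℤ) b + N.message a.1 a.2 (q a.1) b
  rw [Pi.neg_apply, zero_sub]
  exact le_add_of_nonneg_right hmessage

theorem neg_letterCount_le_netChange (w : List (Σ v, A v)) (q : (v : V) → Q v) :
    -intVec (letterCount w) ≤ N.netChange w q := by
  induction w generalizing q with
  | nil => exact (neg_eq_zero.mpr (map_zero intVec)).le
  | cons a w ih =>
    rw [letterCount_cons, map_add, intVec_single_one, neg_add, netChange_cons]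
    exact add_le_add (N.neg_single_le_netChange_singleton a q) (ih _)

theorem legal_of_letterCount_le (w : List (Σ v, A v)) {x : (Σ v, A v) → ℤ}
    (hx : intVec (letterCount w) ≤ x) (q : (v : V) → Q v) : N.Legal w (x, q) := by
  induction w generalizing x q with
  | nil => trivial
  | cons a w ih =>
    rw [letterCount_cons, map_add, intVec_single_one] at hx
    constructor
    · have hxa := hx a
      have hwa := intVec_nonneg (letterCount w) a
      rw [Pi.add_apply, Pi.single_eq_same] at hxa
      rw [Pi.zero_apply] at hwa
      exact (le_add_of_nonneg_right hwa).trans hxa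
    · change N.Legal w (N.exec [a] (x, q))
      rw [exec_eq]
      refine ih ?_ _
      calc intVec (letterCount w)
          ≤ x + -Pi.single a 1 := by rw [← sub_eq_add_neg]; exact le_sub_iff_add_le'.mpr hx
        _ ≤ x + N.netChange [a] q :=
          add_le_add_right (N.neg_single_le_netChange_singleton a q) x

variable {N}

theorem globalAct_zero (hN : N.HaltsOnAllInputs) (q : (v : V) → Q v) : globalAct hN 0 q = q :=
  globalAct_eq hN 0 q [] trivial fun _ => le_rfl

theorem globalAct_eq_of_legal (hN : N.HaltsOnAllInputs) {x y : (Σ v, A v) → ℕ}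
    {q : (v : V) → Q v} {w : List (Σ v, A v)} (hw : N.Legal w (intVec x, q))
    (hy : intVec x + N.netChange w q = intVec y) :
    globalAct hN x q = globalAct hN y (N.finalState w q) := by
  obtain ⟨u, hu, huc⟩ := hN y (N.finalState w q)
  have hexec : N.exec w (intVec x, q) = (intVec y, N.finalState w q) := by rw [exec_eq, hy]
  have hexec' : N.exec (w ++ u) (intVec x, q) = N.exec u (intVec y, N.finalState w q) := by
    rw [exec_append, hexec]
  have hlegal : N.Legal (w ++ u) (intVec x, q) := N.legal_append _ _ _ hw (hexec ▸ hu)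
  rw [globalAct_eq hN x q (w ++ u) hlegal fun a => (congrFun (congrArg Prod.fst hexec') a).le.trans
    (huc a), globalAct_eq hN y _ u hu huc]
  exact congrArg Prod.snd hexec'

theorem exists_word_of_globalAct (hN : N.HaltsOnAllInputs) (x : (Σ v, A v) → ℕ)
    (q : (v : V) → Q v) : ∃ w : List (Σ v, A v), N.netChange w q = -intVec x ∧
      N.finalState w q = globalAct hN x q := by
  obtain ⟨w, hw, hwc⟩ := hN x q
  have hexec := N.exec_eq w (intVec x) q
  refine ⟨w, eq_neg_of_add_eq_zero_right (le_antisymm ?_ ?_), ?_⟩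
  · exact (congrArg Prod.fst hexec).ge.trans hwc
  · exact le_of_le_of_eq (N.exec_nonneg w _ (intVec_nonneg x) hw) (congrArg Prod.fst hexec)
  · exact (congrArg Prod.snd hexec).symm.trans (globalAct_eq hN x q w hw hwc).symm

theorem le_letterCount_of_netChange_eq_neg {w : List (Σ v, A v)} {x : (Σ v, A v) → ℕ}
    {q : (v : V) → Q v} (hw : N.netChange w q = -intVec x) : x ≤ letterCount w := by
  have hle : intVec x ≤ intVec (letterCount w) :=
    neg_le_neg_iff.mp ((N.neg_letterCount_le_netChange w q).trans_eq hw)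
  exact fun a => Int.ofNat_le.mp (hle a)

/-- The map `τ_a` as an element of the global monoid. -/
noncomputable def globalGen (hN : N.HaltsOnAllInputs) (a : Σ v, A v) : globalMonoid hN :=
  ⟨tau hN a, Submonoid.subset_closure ⟨a, rfl⟩⟩

theorem closure_range_globalGen (hN : N.HaltsOnAllInputs) :
    Submonoid.closure (Set.range (globalGen hN)) = ⊤ :=
  closure_range_restrict_eq_top (tau hN)

end Executions

section LetterCounts

variable {V : Type*} [DecidableEq V] {G : Digraph V} {A Q : V → Type*}
  [∀ v, Fintype (A v)] [∀ v, DecidableEq (A v)] {N : Network G A Q}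

theorem finalState_singleton_apply (a : Σ v, A v) (q : (v : V) → Q v) (v : V) :
    N.finalState [a] q v =
      monomial (N.proc v).gen (fun b => (Pi.single a 1 : (Σ v, A v) → ℕ) ⟨v, b⟩) • q v := by
  obtain ⟨u, a⟩ := a
  have hsingle : (fun b => (Pi.single ⟨u, a⟩ 1 : (Σ v, A v) → ℕ) ⟨v, b⟩) =
      (Pi.single u (Pi.single a 1) : (v : V) → A v → ℕ) v :=
    congrFun (Sigma.curry_single (γ := fun _ _ => ℕ) ⟨u, a⟩ 1) v
  change Function.update q u ((N.proc u).t a (q u)) v = _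
  rw [hsingle]
  by_cases hvu : v = u
  · subst hvu
    rw [Function.update_self, Pi.single_eq_same, monomial_single_one]
    rfl
  · rw [Function.update_of_ne hvu, Pi.single_eq_of_ne hvu, monomial_zero, one_smul]

theorem finalState_apply (w : List (Σ v, A v)) (q : (v : V) → Q v) (v : V) :
    N.finalState w q v = monomial (N.proc v).gen (fun a => letterCount w ⟨v, a⟩) • q v := by
  induction w generalizing q with
  | nil => exact ((congrArg (· • q v) (monomial_zero _)).trans (one_smul _ _)).symm
  | cons b w ih =>
    have hcount : (fun a => letterCount (b :: w) ⟨v, a⟩) =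
        (fun a => letterCount w ⟨v, a⟩) +
          fun a => (Pi.single b 1 : (Σ v, A v) → ℕ) ⟨v, a⟩ := by
      rw [letterCount_cons, add_comm]
      rfl
    rw [finalState_cons, ih, finalState_singleton_apply, hcount, monomial_add, mul_smul]

variable [Fintype V]

theorem letterCount_wordOf (k : (Σ v, A v) → ℕ) : letterCount (wordOf k) = k :=
  funext (count_wordOf k)

theorem wordOf_letterCount_perm (w : List (Σ v, A v)) : (wordOf (letterCount w)).Perm w :=
  List.perm_iff_count.mpr (count_wordOf _)

theorem monomial_globalGen_smul (hN : N.HaltsOnAllInputs) (x : (Σ v, A v) → ℕ)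
    (q : (v : V) → Q v) : monomial (globalGen hN) x • q = globalAct hN x q := by
  rw [← letterCount_wordOf x]
  induction wordOf x generalizing q with
  | nil => rw [letterCount_nil, monomial_zero, one_smul, globalAct_zero]
  | cons a w ih =>
    rw [letterCount_cons, globalAct_add, monomial_add, monomial_single_one, mul_comm, mul_smul, ih]
    rfl

theorem IsIrreducible.exists_finalState_eq [∀ v, Finite (Q v)] (hirr : N.IsIrreducible)
    (q : (v : V) → Q v) {q' : (v : V) → Q v} (hq' : q' ∈ N.locallyRecurrent) :
    ∃ w : List (Σ v, A v), N.finalState w q = q' := by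
  choose m hm using fun v => (hirr v).exists_smul_eq (q v) (hq' v)
  choose k hk using fun v => exists_monomial_eq (N.proc v).closure_range_gen (m v)
  refine ⟨wordOf fun a => k a.1 a.2, funext fun v => ?_⟩
  rw [finalState_apply, letterCount_wordOf, hk, hm]

end LetterCounts

section CriticalGroup

variable {V : Type*} [Fintype V] [DecidableEq V] {G : Digraph V} {A Q : V → Type*}
  [∀ v, Fintype (A v)] [∀ v, DecidableEq (A v)] [∀ v, Finite (Q v)] {N : Network G A Q}

theorem toCrit_surjective (hN : N.HaltsOnAllInputs) : Function.Surjective (toCrit hN) :=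
  naturalMap_surjective (closure_range_globalGen hN)

theorem toCrit_intVec_eq_iff (hN : N.HaltsOnAllInputs) {x y : (Σ v, A v) → ℕ} :
    toCrit hN (intVec x) = toCrit hN (intVec y) ↔
      ∀ q ∈ recurrentSet (globalMonoid hN) ((v : V) → Q v),
        globalAct hN x q = globalAct hN y q := by
  change naturalMap (globalGen hN) _ = naturalMap (globalGen hN) _ ↔ _
  rw [naturalMap_intVec, naturalMap_intVec, Additive.ofMul.injective.eq_iff,
    toMinGroup_eq_iff_forall_smul_eq (X := (v : V) → Q v)]
  simp only [monomial_globalGen_smul]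

/-- A recurrent state is `x ▷▷ q` with `x` so large that its executions use every letter needed
to apply the minimal idempotent of each local monoid. -/
theorem recurrentSet_subset_locallyRecurrent (hN : N.HaltsOnAllInputs) :
    recurrentSet (globalMonoid hN) ((v : V) → Q v) ⊆ N.locallyRecurrent := by
  intro q hq v
  choose k hk using fun v => exists_monomial_eq (N.proc v).closure_range_gen
    (minIdempotent (N.proc v).monoid)
  let x : (Σ v, A v) → ℕ := fun a => k a.1 a.2
  obtain ⟨q₀, hq₀⟩ := exists_smul_eq_of_mem_recurrentSet (monomial (globalGen hN) x) hq
  obtain ⟨w, hnet, hfinal⟩ := exists_word_of_globalAct hN x q₀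
  have hxw := le_letterCount_of_netChange_eq_neg hnet
  rw [← hq₀, monomial_globalGen_smul, ← hfinal, finalState_apply]
  exact smul_mem_recurrentSet_of_dvd
    ((hk v).symm.dvd.trans (monomial_dvd_monomial _ fun a => hxw ⟨v, a⟩)) _

end CriticalGroup

section Production

variable {V : Type*} [Fintype V] [DecidableEq V] {G : Digraph V} {A Q : V → Type*}
  [∀ v, Fintype (A v)] [∀ v, DecidableEq (A v)] [∀ v, Finite (Q v)] {N : Network G A Q}
  {q q' : (v : V) → Q v}

theorem IsIrreducible.mem_totalKernel_of_finalState_eq (hirr : N.IsIrreducible)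
    (hq : q ∈ N.locallyRecurrent) {w : List (Σ v, A v)} (hw : N.finalState w q = q) :
    intVec (letterCount w) ∈ N.totalKernel := fun v =>
  (hirr v).mem_kernel (q := ⟨q v, hq v⟩)
    (Subtype.ext ((exec_snd w 0 q hq v).symm.trans (congrFun hw v)))

theorem exec_of_letterCount_mem_totalKernel (hq : q ∈ N.locallyRecurrent) {w : List (Σ v, A v)}
    (hw : intVec (letterCount w) ∈ N.totalKernel) :
    N.exec w (intVec (letterCount w), q) = (productionMap hq ⟨_, hw⟩, q) := by
  rw [← N.exec_perm (wordOf_letterCount_perm w)]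
  exact productionMap_spec hq (letterCount w) hw

theorem finalState_eq_self (hq : q ∈ N.locallyRecurrent) {w : List (Σ v, A v)}
    (hw : intVec (letterCount w) ∈ N.totalKernel) : N.finalState w q = q := by
  simpa only [exec_eq] using congrArg Prod.snd (exec_of_letterCount_mem_totalKernel hq hw)

theorem productionMap_letterCount (hq : q ∈ N.locallyRecurrent) {w : List (Σ v, A v)}
    (hw : intVec (letterCount w) ∈ N.totalKernel) :
    productionMap hq ⟨_, hw⟩ = intVec (letterCount w) + N.netChange w q := by
  simpa only [exec_eq] using (congrArg Prod.fst (exec_of_letterCount_mem_totalKernel hq hw)).symm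

theorem totalKernel_hom_ext {H : Type*} [AddGroup H] {f g : N.totalKernel →+ H}
    (hfg : ∀ (w : List (Σ v, A v)) (hw : intVec (letterCount w) ∈ N.totalKernel),
      f ⟨_, hw⟩ = g ⟨_, hw⟩) : f = g := by
  refine addMonoidHom_ext_of_nonneg N.exists_smul_mem_totalKernel fun ⟨k, hk⟩ hk₀ => ?_
  obtain ⟨k, rfl⟩ := exists_intVec_eq hk₀
  obtain ⟨w, rfl⟩ : ∃ w, letterCount w = k := ⟨_, letterCount_wordOf k⟩
  exact hfg w hk

theorem IsIrreducible.productionMap_eq (hirr : N.IsIrreducible) (hq : q ∈ N.locallyRecurrent)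
    (hq' : q' ∈ N.locallyRecurrent) : productionMap hq = productionMap hq' := by
  refine totalKernel_hom_ext fun w hw => ?_
  obtain ⟨u, hu⟩ := hirr.exists_finalState_eq q hq'
  have hcomm : N.netChange (w ++ u) q = N.netChange (u ++ w) q :=
    congrArg Prod.fst (N.exec_perm List.perm_append_comm _)
  rw [netChange_append, netChange_append, finalState_eq_self hq hw, hu, add_comm,
    add_right_inj] at hcomm
  rw [productionMap_letterCount, productionMap_letterCount, hcomm]

theorem IsIrreducible.toCrit_comp_productionMap (hirr : N.IsIrreducible)
    (hN : N.HaltsOnAllInputs) (hq : q ∈ N.locallyRecurrent) :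
    (toCrit hN).comp (productionMap hq) = (toCrit hN).comp N.totalKernel.subtype := by
  refine totalKernel_hom_ext fun w hw => ?_
  change toCrit hN (productionMap hq ⟨_, hw⟩) = toCrit hN (intVec (letterCount w))
  have hnonneg : 0 ≤ productionMap hq ⟨_, hw⟩ := by
    rw [productionMap_letterCount]
    exact neg_le_iff_add_nonneg'.mp (N.neg_letterCount_le_netChange w q)
  obtain ⟨y, hy⟩ := exists_intVec_eq hnonneg
  rw [← hy, eq_comm, toCrit_intVec_eq_iff]
  intro q' hq'
  have hlocal := recurrentSet_subset_locallyRecurrent hN hq'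
  have hnet : intVec (letterCount w) + N.netChange w q' = intVec y := by
    rw [← productionMap_letterCount hlocal hw, hy, hirr.productionMap_eq hq hlocal]
  rw [globalAct_eq_of_legal hN (N.legal_of_letterCount_le w le_rfl q') hnet,
    finalState_eq_self hlocal hw]

/-- Closing both words up to loops at `q` by the same return word puts their letter counts in
`K`. -/
theorem IsIrreducible.exists_sub_productionMap_eq (hirr : N.IsIrreducible)
    (hq : q ∈ N.locallyRecurrent) {w u : List (Σ v, A v)}
    (hwu : N.finalState w q = N.finalState u q) :
    ∃ k : N.totalKernel, k - productionMap hq k = N.netChange u q - N.netChange w q := by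
  obtain ⟨c, hc⟩ := hirr.exists_finalState_eq (N.finalState u q) hq
  have hu : intVec (letterCount (u ++ c)) ∈ N.totalKernel :=
    hirr.mem_totalKernel_of_finalState_eq hq (by rw [finalState_append, hc])
  have hw : intVec (letterCount (w ++ c)) ∈ N.totalKernel :=
    hirr.mem_totalKernel_of_finalState_eq hq (by rw [finalState_append, hwu, hc])
  refine ⟨⟨_, hw⟩ - ⟨_, hu⟩, ?_⟩
  rw [map_sub, productionMap_letterCount, productionMap_letterCount, netChange_append,
    netChange_append, hwu, AddSubgroup.coe_sub]
  abel

theorem IsIrreducible.ker_toCrit (hirr : N.IsIrreducible) (hN : N.HaltsOnAllInputs)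
    (hq : q ∈ N.locallyRecurrent) :
    (toCrit hN).ker = (N.totalKernel.subtype - productionMap hq).range := by
  refine le_antisymm (fun x hx => ?_) ?_
  · obtain ⟨a, b, rfl⟩ := exists_intVec_sub_intVec_eq x
    obtain ⟨q', hq'⟩ : (recurrentSet (globalMonoid hN) ((v : V) → Q v)).Nonempty := ⟨_, q, rfl⟩
    have hlocal := recurrentSet_subset_locallyRecurrent hN hq'
    rw [AddMonoidHom.mem_ker, map_sub, sub_eq_zero, toCrit_intVec_eq_iff] at hx
    obtain ⟨w, hw, hwq⟩ := exists_word_of_globalAct hN a q'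
    obtain ⟨u, hu, huq⟩ := exists_word_of_globalAct hN b q'
    obtain ⟨k, hk⟩ := hirr.exists_sub_productionMap_eq hlocal
      (hwq.trans ((hx q' hq').trans huq.symm))
    rw [hirr.productionMap_eq hq hlocal]
    refine ⟨k, hk.trans ?_⟩
    rw [hw, hu, neg_sub_neg]
  · rintro _ ⟨k, rfl⟩
    change toCrit hN (k - productionMap hq k) = 0
    rw [map_sub, sub_eq_zero]
    exact (DFunLike.congr_fun (hirr.toCrit_comp_productionMap hN hq) k).symm

end Production

section Laplacian

variable {V : Type*} [Fintype V] [DecidableEq V] {G : Digraph V} {A Q : V → Type*}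
  [∀ v, Fintype (A v)] [∀ v, DecidableEq (A v)] [∀ v, Finite (Q v)] {N : Network G A Q}
  {q : (v : V) → Q v}

theorem mem_totalKernel_of_resetNumber_dvd {x : (Σ v, A v) → ℤ}
    (hx : ∀ a, (N.resetNumber a : ℤ) ∣ x a) : x ∈ N.totalKernel := by
  rw [← Finset.univ_sum_single x]
  refine N.totalKernel.sum_mem fun a _ => ?_
  obtain ⟨c, hc⟩ := hx a
  have hsingle : (Pi.single a (x a) : (Σ v, A v) → ℤ) =
      c • (N.resetNumber a : ℤ) • Pi.single a 1 := by
    rw [← Pi.single_smul, ← Pi.single_smul, smul_eq_mul, smul_eq_mul, mul_one, hc, mul_comm]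
  rw [hsingle]
  exact N.totalKernel.zsmul_mem (N.resetNumber_spec a).2 c

theorem laplacian_mulVec (hq : q ∈ N.locallyRecurrent) {y : (Σ v, A v) → ℤ}
    {k : N.totalKernel} (hk : ∀ a, k.1 a = N.resetNumber a * y a) :
    (laplacian hq).mulVec (fun a => (y a : ℚ)) =
      fun a => (((k.1 - productionMap hq k) a : ℤ) : ℚ) := by
  have hD : (Matrix.diagonal fun a => (N.resetNumber a : ℚ)).mulVec (fun a => (y a : ℚ)) =
      fun a => (k.1 a : ℚ) := by
    ext a
    rw [Matrix.mulVec_diagonal, hk, Int.cast_mul, Int.cast_natCast]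
  rw [laplacian, ← Matrix.mulVec_mulVec, hD, Matrix.sub_mulVec, Matrix.one_mulVec,
    productionMatrix_mulVec]
  ext a
  simp only [Pi.sub_apply, Int.cast_sub]

theorem mem_laplacianImage_iff (hq : q ∈ N.locallyRecurrent) {x : (Σ v, A v) → ℤ} :
    x ∈ laplacianImage hq ↔ ∃ k : N.totalKernel,
      (∀ a, (N.resetNumber a : ℤ) ∣ k.1 a) ∧ k - productionMap hq k = x := by
  have hcast : Function.Injective fun (x : (Σ v, A v) → ℤ) a => (x a : ℚ) :=
    Int.cast_injective.comp_left
  constructor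
  · rintro ⟨y, hy⟩
    have hdvd (a : Σ v, A v) : (N.resetNumber a : ℤ) ∣ N.resetNumber a * y a := dvd_mul_right _ _
    refine ⟨⟨_, mem_totalKernel_of_resetNumber_dvd hdvd⟩, hdvd, hcast ?_⟩
    exact (hy.trans (laplacian_mulVec hq fun _ => rfl)).symm
  · rintro ⟨k, hk, rfl⟩
    choose y hy using hk
    exact ⟨y, (laplacian_mulVec hq hy).symm⟩

theorem laplacianImage_le_range (hq : q ∈ N.locallyRecurrent) :
    laplacianImage hq ≤ (N.totalKernel.subtype - productionMap hq).range := fun _ hx =>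
  let ⟨k, _, hk⟩ := (mem_laplacianImage_iff hq).mp hx
  ⟨k, hk⟩

theorem IsRectangular.laplacianImage_eq_range (hrect : N.IsRectangular)
    (hq : q ∈ N.locallyRecurrent) :
    laplacianImage hq = (N.totalKernel.subtype - productionMap hq).range := by
  refine (laplacianImage_le_range hq).antisymm ?_
  rintro _ ⟨k, rfl⟩
  exact (mem_laplacianImage_iff hq).mpr ⟨k, (hrect k).mp k.2, rfl⟩

end Laplacian

end Network

end AbelianNet

theorem corollary3p14 {V : Type*} [Fintype V] [DecidableEq V] {G : Digraph V} {A Q : V → Type*}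
    [∀ v, Fintype (A v)] [∀ v, DecidableEq (A v)] [∀ v, Finite (Q v)]
    (N : AbelianNet.Network G A Q) (hirr : N.IsIrreducible) (hN : N.HaltsOnAllInputs)
    (q : (v : V) → Q v) (hq : q ∈ N.locallyRecurrent) :
    ∃ φ : ((Σ v, A v) → ℤ) ⧸ AbelianNet.Network.laplacianImage hq →+
        Additive (AbelianNet.Network.Crit hN),
      (∀ x : (Σ v, A v) → ℤ, φ (QuotientAddGroup.mk x) = AbelianNet.Network.toCrit hN x) ∧
      Function.Surjective φ ∧
      (N.IsRectangular → Function.Bijective φ) := by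
  have hker := hirr.ker_toCrit hN hq
  have hsurj := AbelianNet.Network.toCrit_surjective hN
  have hle := (AbelianNet.Network.laplacianImage_le_range hq).trans_eq hker.symm
  exact ⟨QuotientAddGroup.lift _ (AbelianNet.Network.toCrit hN) hle, fun _ => rfl,
    QuotientAddGroup.lift_surjective_of_surjective _ _ hsurj hle, fun hrect =>
    (QuotientAddGroup.liftEquiv _ hsurj
      ((hrect.laplacianImage_eq_range hq).trans hker.symm)).bijective⟩
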